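/- **Model $\mathbf{Det}(\beta<1)$.** There are $k\le n$ machines $M_1,\dots,M_k$ and an input array $x\in\{0,1\}^n$ stored in a read-only cloud. Time proceeds in synchronous rounds. In each round a machine first issues queries $\mathtt{Cloud\_Query}(i)$, which are answered by $x_i$, and then sends at most one message of $O(\log n)$ bits to each other machine; the messages arrive, with the identity of the sender, by the end of the round. The number $\beta\in(0,1)$ is known to the machines and $\beta k$ is an integer. An all-knowing adversary chooses $x$, a set of at most $\beta k$ Byzantine machines, and all the messages they send; the other (honest) machines follow the deterministic algorithm until they return. $\mathcal Q$ is the maximum number of queries made by an honest machine, $\mathcal M$ the total number of messages sent by honest machines, and $\mathcal T$ the number of rounds until all honest machines have returned. *Disjunction* requires every honest machine to return $x_1\vee\dots\vee x_n$. Let $\delta=\frac1n|\{i:x_i=1\}|$ and $\bar\delta=\max(1/n,\delta)$. Write $\log=\log_2$. **Large set expanders.** A bipartite graph with sides $L,R$, $|L|=n$, $|R|=k$, is an $(n,k,\beta,\eta)$-LSE if $|\Gamma(S)|>\beta k$ for all $S\subseteq L$ with $|S|\ge \eta n$. Let $d(\eta)$ be the least natural number strictly larger than $$\max\left\{\frac{1+\log\left(e/\max(1/n,\eta)\right)}{\log(1/\beta)}+\frac{\beta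 k}{\eta n}\cdot\frac{\log(e/\beta)}{\log(1/\beta)},\ \frac{3k\ln(2k)}{n}\right\}.$$ Call graphs $G_1,\dots,G_{\lceil\log n\rceil}$ on $L=\{1,\dots,n\}$ (the bits) and $R=\{M_1,\dots,M_k\}$ *admissible* if each $G_r$ is an $(n,k,\beta,2^{-r})$-LSE in which every vertex of $L$ has degree at most $d(2^{-r})$ and every vertex of $R$ has degree at most $2n\,d(2^{-r})/k$. **Algorithm $\mathtt{LSE\_Disjunct\_1}$** (for fixed admissible $G_1,\dots,G_{\lceil\log n\rceil}$; code of $M_\ell$, which keeps a blacklist, initially empty). For $r=1,\dots,\lceil\log n\rceil$: (a) query all bits in the neighbourhood of $M_\ell$ in $G_r$; if some queried bit $x_j$ is $1$, send $j$ to all other machines and return $1$; receive the indices sent by the others. (b) For every machine that is not blacklisted and every index $i$ it sent in step (a) of this phase or in step (b) of the previous phase, query $x_i$, and blacklist the sender if $x_i=0$; if some $x_i=1$ was found, send $i$ to all other machines and return $1$; receive the indices sent by the others. After the last phase, query all $n$ bits and return $0$ if all are $0$, and $1$ otherwise. **Theorem.** There is an absolute constant $C>0$ such that for all integers $1\le k\le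 n$ and all $\beta\in(0,1)$ with $\beta k$ an integer, admissible graphs $G_1,\dots,G_{\lceil\log n\rceil}$ exist, and for every admissible choice and every behaviour of the adversary, $\mathtt{LSE\_Disjunct\_1}$ solves Disjunction. Moreover, with $$q=\frac nk\left(\log_{1/\beta}\frac{e^2}{\bar\delta}+\log k\right)\max\left(1,\log\frac1{\bar\delta}\right)+\frac1{\bar\delta}\,\beta\log_{1/\beta}\frac e\beta+k,$$ one has $\mathcal Q\le \frac C\beta\, q$, and even $\mathcal Q\le C\,q$ if $\delta>0$; $\mathcal T\le C\log n$; and $\mathcal M\le\frac C\beta\cdot\beta k^2\log n$. In particular, for every fixed $\beta$, $\mathcal Q=O(q)$, $\mathcal T=O(\log n)$ and $\mathcal M=O(\beta k^2\log n)$. -/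

import Mathlib

/-! ### The deterministic congested clique with cloud assistance -/

/-- A deterministic algorithm for `k` machines and an `n`-bit cloud array.  One round of a running
machine consists of a query sub-round (all queries are issued at once and then answered) and a
message-passing sub-round.  In one round a machine sends at most one message to each machine, and a
message is an index in `Fin n`, i.e. it has at most `⌈log₂ n⌉` bits.  Queries form a list, so that
a repeated query is charged repeatedly. -/
structure CCAProtocol (n k : ℕ) where
  State : Type
  init : Fin k → State
  /-- the queries issued by a machine at the beginning of a round -/
  queries : Fin k → State → List (Fin n)
  /-- local computation after the query sub-round; `none` marks a bit that was not queried -/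
  absorb : Fin k → State → (Fin n → Option Bool) → State
  /-- the messages sent afterwards, one optional message for each recipient -/
  send : Fin k → State → Fin k → Option (Fin n)
  /-- local computation after the message-passing sub-round, from the messages of all senders -/
  receive : Fin k → State → (Fin k → Option (Fin n)) → State
  /-- the value returned so far; a machine that has returned stays silent from the next round on -/
  output : State → Option Bool

/-- What the adversary fixes: the input, the Byzantine machines and all their messages.
`byzMsg t i j` is what the Byzantine machine `i` sends to `j` in round `t`.  Since the algorithm is
deterministic, quantifying over all message tables is the same as quantifying over all strategies
of an all-knowing adversary. -/
structure CCAAdversary (n k : ℕ) where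
  input : Fin n → Bool
  byz : Finset (Fin k)
  byzMsg : ℕ → Fin k → Fin k → Option (Fin n)

namespace CCAProtocol

variable {n k : ℕ} (P : CCAProtocol n k) (A : CCAAdversary n k)

/-- Queries made by machine `i` in a round which it starts in state `s`. -/
def roundQueries (i : Fin k) (s : P.State) : List (Fin n) :=
  if (P.output s).isSome then [] else P.queries i s

/-- State of machine `i` after the query sub-round. -/
def afterQueries (i : Fin k) (s : P.State) : P.State :=
  if (P.output s).isSome then s
  else P.absorb i s (fun x => if x ∈ P.queries i s then some (A.input x) else none)

/-- Messages which machine `i`, following the algorithm, sends in a round started in state `s`. -/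
def roundMessages (i : Fin k) (s : P.State) (j : Fin k) : Option (Fin n) :=
  if (P.output s).isSome then none else P.send i (P.afterQueries A i s) j

/-- State of machine `i` after `t` rounds (relevant for honest machines only). -/
def state : ℕ → Fin k → P.State
  | 0, i => P.init i
  | t + 1, i =>
      if (P.output (state t i)).isSome then state t i
      else P.receive i (P.afterQueries A i (state t i))
        (fun j => if j ∈ A.byz then A.byzMsg t j i else P.roundMessages A j (state t j) i)

/-- Every honest machine returns the OR of the input bits. -/
def SolvesDisjunction : Prop :=
  ∀ i ∉ A.byz, ∃ t, P.output (P.state A t i) = some (decide (∃ x, A.input x = true))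

/-- Round complexity: the number of rounds until all honest machines have returned. -/
noncomputable def roundComplexity : ℕ :=
  sInf {t | ∀ i ∉ A.byz, (P.output (P.state A t i)).isSome}

/-- Query complexity: the maximum number of queries made by an honest machine. -/
noncomputable def queryComplexity : ℕ :=
  (A.byzᶜ).sup fun i =>
    ∑ t ∈ Finset.range (P.roundComplexity A), (P.roundQueries i (P.state A t i)).length

/-- Message complexity: the total number of messages sent by honest machines. -/
noncomputable def messageComplexity : ℕ :=
  ∑ t ∈ Finset.range (P.roundComplexity A), ∑ i ∈ A.byzᶜ,
    (Finset.univ.filter fun j => (P.roundMessages A i (P.state A t i) j).isSome).card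

end CCAProtocol

/-- The density: the fraction of ones in the input. -/
noncomputable def CCAAdversary.density {n k : ℕ} (A : CCAAdversary n k) : ℝ :=
  ((Finset.univ.filter fun x => A.input x = true).card : ℝ) / n

/-- The modified density `max (1/n, δ)`. -/
noncomputable def modDensity (n : ℕ) (δ : ℝ) : ℝ := max (1 / (n : ℝ)) δ

/-! ### Large set expanders -/

/-- A bipartite graph with left side `Fin n` (bits) and right side `Fin k` (machines), given by the
neighbourhoods of the left vertices. -/
abbrev BipGraph (n k : ℕ) := Fin n → Finset (Fin k)

/-- The neighbourhood of a right vertex. -/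
def BipGraph.rightNbrs {n k : ℕ} (G : BipGraph n k) (j : Fin k) : Finset (Fin n) :=
  Finset.univ.filter fun i => j ∈ G i

/-- `(n, k, β, δ)`-large set expander: `|Γ(S)| > βk` whenever `|S| ≥ nδ`. -/
def IsLSE {n k : ℕ} (β δ : ℝ) (G : BipGraph n k) : Prop :=
  ∀ S : Finset (Fin n), (n : ℝ) * δ ≤ S.card → β * k < (S.biUnion G).card

/-- The bound which the degree parameter `d` of a large set expander has to exceed. -/
noncomputable def lseThreshold (n k : ℕ) (β δ : ℝ) : ℝ :=
  max ((1 + Real.logb 2 (Real.exp 1 * (1 / modDensity n δ))) / Real.logb 2 (1 / β)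
        + β * k / (δ * n) * (Real.logb 2 (Real.exp 1 / β) / Real.logb 2 (1 / β)))
    (3 * k * Real.log (2 * k) / n)

/-- The least natural number strictly above `lseThreshold`. -/
noncomputable def lseDegree (n k : ℕ) (β δ : ℝ) : ℕ := ⌊lseThreshold n k β δ⌋₊ + 1

/-- `G r` is, for every phase `r = 1, …, ⌈log₂ n⌉`, an `(n, k, β, 1/2^r)`-LSE whose left degrees are
at most `d` and whose right degrees are at most `2nd/k`, for `d` the least admissible degree. -/
def IsLSEFamily {n k : ℕ} (β : ℝ) (G : ℕ → BipGraph n k) : Prop :=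
  ∀ r ∈ Finset.Icc 1 (Nat.clog 2 n),
    IsLSE β (1 / 2 ^ r) (G r) ∧
    (∀ i, (G r i).card ≤ lseDegree n k β (1 / 2 ^ r)) ∧
    (∀ j, (((G r).rightNbrs j).card : ℝ) ≤ 2 * n * lseDegree n k β (1 / 2 ^ r) / k)

/-! ### The algorithm `LSE_Disjunct_1` -/

/-- Local state of a machine. Rounds `2(r-1)` and `2(r-1)+1` form phase `r`, and round
`2⌈log₂ n⌉` is the final one. -/
structure LSEState (n k : ℕ) where
  round : ℕ
  /-- the bits learnt from the cloud -/
  res : Fin n → Option Bool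
  /-- machines blacklisted as Byzantine -/
  blacklist : Finset (Fin k)
  /-- indices received in the first round of the present phase -/
  inbox : Fin k → Option (Fin n)
  /-- indices received in the last round of the previous phase -/
  prevInbox : Fin k → Option (Fin n)
  /-- index to be sent to all other machines in the present round -/
  announce : Option (Fin n)
  out : Option Bool

namespace LSEState

variable {n k : ℕ}

/-- The claims `x_i = 1` of machine `j` to be verified in the second round of a phase. -/
def claims (s : LSEState n k) (j : Fin k) : List (Fin n) :=
  (s.inbox j).toList ++ (s.prevInbox j).toList

/-- The queries at the beginning of a round of machine `l`: its neighbours in `G r` in the first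
round of phase `r`, the indices sent by machines outside the blacklist in the second round, and
everything in the final round. -/
def queries (G : ℕ → BipGraph n k) (l : Fin k) (s : LSEState n k) : List (Fin n) :=
  if s.round < 2 * Nat.clog 2 n then
    if Even s.round then
      (List.finRange n).filter fun i => decide (i ∈ (G (s.round / 2 + 1)).rightNbrs l)
    else
      ((List.finRange k).filter fun j => decide (j ∉ s.blacklist)).flatMap s.claims
  else List.finRange n

/-- Record the answers; in the second round of a phase, blacklist machines caught in a false claim;
if a set bit is known, prepare to send (the first) such index and return `1`.  In the final round,
return `0` if all bits are `0` and `1` otherwise. -/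
def absorb (s : LSEState n k) (ans : Fin n → Option Bool) : LSEState n k :=
  let res' : Fin n → Option Bool := fun i => (ans i).or (s.res i)
  if s.round < 2 * Nat.clog 2 n then
    let found := (List.finRange n).find? fun i => decide (res' i = some true)
    { s with
      res := res'
      blacklist :=
        if Even s.round then s.blacklist
        else s.blacklist ∪ Finset.univ.filter fun j => ∃ i ∈ s.claims j, res' i = some false
      announce := found
      out := if found.isSome then some true else none }
  else
    { s with
      res := res'
      announce := none
      out := if ∀ i, res' i = some false then some false else some true }

/-- Store the received indices and go on to the next round. -/
def receive (s : LSEState n k) (msgs : Fin k → Option (Fin n)) : LSEState n k :=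
  if Even s.round then { s with round := s.round + 1, inbox := msgs }
  else { s with round := s.round + 1, inbox := fun _ => none, prevInbox := msgs }

end LSEState

/-- Algorithm `LSE_Disjunct_1`, run with the graphs `G 1, …, G ⌈log₂ n⌉`. -/
def lseDisjunct1 {n k : ℕ} (G : ℕ → BipGraph n k) : CCAProtocol n k where
  State := LSEState n k
  init := fun _ =>
    { round := 0
      res := fun _ => none
      blacklist := ∅
      inbox := fun _ => none
      prevInbox := fun _ => none
      announce := none
      out := none }
  queries := fun l s => s.queries G l
  absorb := fun _ s ans => s.absorb ans
  send := fun l s j => if j = l then none else s.announce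
  receive := fun _ s msgs => s.receive msgs
  output := fun s => s.out

/-- The expression in the bound on the query complexity, for modified density `D`; the factor
`log₂ (1/D)` is read as at least `1`. -/
noncomputable def disjunctQueryBound (n k : ℕ) (β D : ℝ) : ℝ :=
  (n : ℝ) / k * (Real.logb (1 / β) (Real.exp 1 ^ 2 * (1 / D)) + Real.logb 2 k)
      * max 1 (Real.logb 2 (1 / D))
    + 1 / D * (β * Real.logb (1 / β) (Real.exp 1 / β)) + k

/-! Existence of the graphs is a counting argument. Let every bit draw `d` machines uniformly with
repetition, and put `s = ⌈nη⌉`, `b = βk`. If expansion fails, some `s` bits have all their draws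
inside some `b` machines. A fixed pair has probability `β ^ (s * d)`, and the first part of the
threshold makes the union bound over all pairs smaller than 1/2. By a Chernoff bound and the second
part, a fixed machine is drawn more than `2nd/k` times with probability below `1/(2k)`. Hence some
outcome avoids both defects (`exists_lse`).

Correctness rests on one invariant (`lseInvariant`): honest machines announce only indices they have
read as ones. They are therefore never blacklisted, a `1` is returned early only after a one has
been seen, and a machine that never sees one ends by reading the whole input.

For the speed, let `R ≥ 1` be the first phase with `2^(-R) ≤ δ`. The ones have more than `βk`
neighbours in `G R`, so some honest machine meets a one by the first round of phase `R`. The others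
verify its message, so all honest machines return by the end of that phase (`lseRun_out_of_isLSE`),
and `2 ^ R ≤ 2 / δ`.

Verification costs at most `2k` queries in total, since a checked sender either proves a one or is
blacklisted (`sum_lseQueries_le`). The graph queries are `2nd/k` per phase: the nearly constant part
of the degree is paid `R` times, while the part proportional to `2 ^ r` sums geometrically to the
order of `1 / D`, where `D` is the modified density. On the zero input all phases run with `D =
1/n`, and the final scan of `n` bits is at most `q / β` because `q ≥ β / D`. -/

/-! ### Existence of large set expanders -/

/-- The graph in which bit `i` is joined to the machines drawn in `ω (i, ·)`. -/
def BipGraph.ofDraws {n k d : ℕ} (ω : Fin n × Fin d → Fin k) : BipGraph n k :=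
  fun i => Finset.univ.image fun a => ω (i, a)

theorem BipGraph.card_ofDraws_le {n k d : ℕ} (ω : Fin n × Fin d → Fin k) (i : Fin n) :
    (BipGraph.ofDraws ω i).card ≤ d := by
  simpa [BipGraph.ofDraws] using
    (Finset.card_image_le (s := Finset.univ) (f := fun a => ω (i, a)))

theorem BipGraph.card_rightNbrs_ofDraws_le {n k d : ℕ} (ω : Fin n × Fin d → Fin k) (j : Fin k) :
    ((BipGraph.ofDraws ω).rightNbrs j).card ≤ (Finset.univ.filter fun p => ω p = j).card := by
  have h : (BipGraph.ofDraws ω).rightNbrs j ⊆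
      (Finset.univ.filter fun p => ω p = j).image Prod.fst := by
    intro i hi
    simp only [BipGraph.rightNbrs, BipGraph.ofDraws, Finset.mem_filter, Finset.mem_univ,
      Finset.mem_image, true_and] at hi
    obtain ⟨a, ha⟩ := hi
    simp only [Finset.mem_image, Finset.mem_filter, Finset.mem_univ, true_and]
    exact ⟨(i, a), ha, rfl⟩
  exact (Finset.card_le_card h).trans Finset.card_image_le

/-- The number of draws which send all of `S` into `T`. -/
theorem card_draws_subset {n k d : ℕ} (S : Finset (Fin n)) (T : Finset (Fin k)) {β : ℝ}
    (hT : (T.card : ℝ) = β * k) :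
    ((Finset.univ.filter fun ω : Fin n × Fin d → Fin k => ∀ p, p.1 ∈ S → ω p ∈ T).card : ℝ)
      = (k : ℝ) ^ (n * d) * β ^ (S.card * d) := by
  classical
  have h : (Finset.univ.filter fun ω : Fin n × Fin d → Fin k => ∀ p, p.1 ∈ S → ω p ∈ T)
      = Fintype.piFinset fun p : Fin n × Fin d => if p.1 ∈ S then T else Finset.univ := by
    ext ω
    simp only [Finset.mem_filter, Finset.mem_univ, true_and, Fintype.mem_piFinset]
    refine forall_congr' fun p => ?_
    by_cases hp : p.1 ∈ S <;> simp [hp]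
  rw [h, Fintype.card_piFinset, Nat.cast_prod]
  -- A draw of a bit in `S` has `βk` allowed values, any other draw has `k`.
  have h2 : ∀ p : Fin n × Fin d, (((if p.1 ∈ S then T else Finset.univ).card : ℕ) : ℝ)
      = k * (if p.1 ∈ S then β else 1) := by
    intro p
    by_cases hp : p.1 ∈ S
    · simp [hp, hT, mul_comm]
    · simp [hp]
  rw [Finset.prod_congr rfl fun p _ => h2 p, Finset.prod_mul_distrib]
  congr 1
  · simp
  · rw [Fintype.prod_prod_type]
    have : ∀ x : Fin n, ∏ _y : Fin d, (if x ∈ S then β else 1) = if x ∈ S then β ^ d else 1 := by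
      intro x; split_ifs <;> simp
    rw [Finset.prod_congr rfl fun x _ => this x]
    rw [Finset.prod_ite_mem, Finset.univ_inter, Finset.prod_const, ← pow_mul, mul_comm]

/-- Exponential moment of the number of draws hitting a machine. -/
theorem sum_two_pow_hits {n k d : ℕ} (j : Fin k) :
    ∑ ω : Fin n × Fin d → Fin k, (2 : ℝ) ^ (Finset.univ.filter fun p => ω p = j).card
      = ((k : ℝ) + 1) ^ (n * d) := by
  classical
  have h : ∀ ω : Fin n × Fin d → Fin k,
      (2 : ℝ) ^ (Finset.univ.filter fun p => ω p = j).card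
        = ∏ p, if ω p = j then (2 : ℝ) else 1 := by
    intro ω
    rw [Finset.prod_ite]
    simp
  simp only [h]
  -- The draws are independent: the sum over all outcomes of a product over coordinates factors,
  -- each factor being `2 + (k - 1)`.
  have := Finset.prod_univ_sum (fun _ : Fin n × Fin d => (Finset.univ : Finset (Fin k)))
    (fun _ m => if m = j then (2 : ℝ) else 1)
  rw [Fintype.piFinset_univ] at this
  rw [← this]
  have h3 : ∑ m : Fin k, (if m = j then (2 : ℝ) else 1) = k + 1 := by
    have : ∀ m : Fin k, (if m = j then (2 : ℝ) else 1) = (if m = j then 1 else 0) + 1 := by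
      intro m; split_ifs <;> norm_num
    simp only [this, Finset.sum_add_distrib]
    simp [add_comm]
  simp [h3]

/-- Chernoff bound for the number of draws hitting a machine. -/
theorem card_draws_many_hits_lt {n k d : ℕ} (hk : 0 < k) (j : Fin k)
    (hd : 3 * Real.log (2 * k) < (n : ℝ) * d / k) :
    ((Finset.univ.filter fun ω : Fin n × Fin d → Fin k =>
        2 * (n : ℝ) * d / k < (Finset.univ.filter fun p => ω p = j).card).card : ℝ)
      < (k : ℝ) ^ (n * d) * (1 / (2 * k)) := by
  classical
  set B := Finset.univ.filter fun ω : Fin n × Fin d → Fin k =>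
        2 * (n : ℝ) * d / k < (Finset.univ.filter fun p => ω p = j).card with hB
  have hk' : (0 : ℝ) < k := by exact_mod_cast hk
  have hk1 : (1 : ℝ) ≤ k := by exact_mod_cast hk
  set μ : ℝ := (n : ℝ) * d / k with hμ
  -- Markov's inequality for `2 ^ X`, with `X` the number of hits.
  have h1 : (B.card : ℝ) * Real.exp (2 * μ * Real.log 2) ≤ ((k : ℝ) + 1) ^ (n * d) := by
    rw [← sum_two_pow_hits j, ← nsmul_eq_mul, ← Finset.sum_const]
    refine (Finset.sum_le_sum (g := fun ω : Fin n × Fin d → Fin k =>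
      (2 : ℝ) ^ (Finset.univ.filter fun p => ω p = j).card) ?_).trans
      (Finset.sum_le_sum_of_subset_of_nonneg (Finset.subset_univ _) fun _ _ _ => by positivity)
    intro ω hω
    rw [hB, Finset.mem_filter] at hω
    have h2 := hω.2
    rw [← Real.rpow_natCast, Real.rpow_def_of_pos two_pos]
    apply Real.exp_le_exp.2
    have : 2 * μ ≤ (Finset.univ.filter fun p => ω p = j).card := by
      rw [hμ]; refine le_trans (le_of_eq ?_) h2.le; ring
    nlinarith [Real.log_pos one_lt_two]
  have h2 : ((k : ℝ) + 1) ^ (n * d) ≤ (k : ℝ) ^ (n * d) * Real.exp μ := by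
    have : (k : ℝ) + 1 ≤ k * Real.exp (1 / k) := by
      have := Real.add_one_le_exp (1 / (k : ℝ))
      calc (k : ℝ) + 1 = k * (1 / k + 1) := by field_simp; ring
        _ ≤ _ := by gcongr
    calc ((k : ℝ) + 1) ^ (n * d) ≤ (k * Real.exp (1 / k)) ^ (n * d) := by gcongr
      _ = _ := by
        rw [mul_pow, ← Real.exp_nat_mul]
        congr 2
        rw [hμ]; push_cast; ring
  -- The exponent gained is `(2 log 2 - 1) μ`. As `2 log 2 - 1 > 1/3`, the constant 3 in the
  -- hypothesis suffices.
  have h3 : Real.exp μ < Real.exp (2 * μ * Real.log 2) * (1 / (2 * k)) := by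
    have e : (1 / (2 * k) : ℝ) = Real.exp (- Real.log (2 * k)) := by
      rw [Real.exp_neg, Real.exp_log (by positivity), one_div]
    rw [e, ← Real.exp_add]
    apply Real.exp_lt_exp.2
    have hl : 0 ≤ Real.log (2 * k) := Real.log_nonneg (by linarith)
    nlinarith [Real.log_two_gt_d9]
  have hpos : 0 < Real.exp (2 * μ * Real.log 2) := Real.exp_pos _
  have h4 : (B.card : ℝ) * Real.exp (2 * μ * Real.log 2)
      < (k : ℝ) ^ (n * d) * (1 / (2 * k)) * Real.exp (2 * μ * Real.log 2) := by
    refine (h1.trans h2).trans_lt ?_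
    have : (0 : ℝ) < (k : ℝ) ^ (n * d) := by positivity
    nlinarith
  exact lt_of_mul_lt_mul_right h4 hpos.le

/-- This is `(en/s)^s` in exponential form; it follows from `s^s / s! ≤ e^s`, a single term of the
exponential series. -/
theorem choose_le_exp {n s : ℕ} (hs : 0 < s) (hn : 0 < n) :
    (n.choose s : ℝ) ≤ Real.exp (s * (1 + Real.log (n / s))) := by
  have hs' : (0 : ℝ) < s := by exact_mod_cast hs
  have hn' : (0 : ℝ) < n := by exact_mod_cast hn
  have h1 : (n.choose s : ℝ) ≤ (n : ℝ) ^ s / s.factorial := Nat.choose_le_pow_div s n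
  have h2 : (s : ℝ) ^ s / s.factorial ≤ Real.exp s := Real.pow_div_factorial_le_exp _ hs'.le s
  have h3 : Real.exp (s * (1 + Real.log (n / s))) = Real.exp s * (n / s : ℝ) ^ s := by
    rw [mul_add, Real.exp_add, mul_one, Real.exp_nat_mul, Real.exp_log (by positivity)]
  rw [h3]
  refine h1.trans ?_
  calc (n : ℝ) ^ s / s.factorial = (s : ℝ) ^ s / s.factorial * (n / s : ℝ) ^ s := by
        rw [div_pow]; field_simp
    _ ≤ _ := by gcongr

/-- The threshold in terms of natural logarithms. -/
theorem lseThreshold_eq {n k : ℕ} {β δ : ℝ} (hn : 0 < n) :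
    lseThreshold n k β δ =
      max ((Real.log 2 + 1 + Real.log (1 / modDensity n δ)) / Real.log (1 / β)
        + β * k / (δ * n) * (Real.log (Real.exp 1 / β) / Real.log (1 / β)))
        (3 * k * Real.log (2 * k) / n) := by
  have hm : 0 < modDensity n δ := lt_max_of_lt_left (by positivity)
  have h2 : Real.log 2 ≠ 0 := (Real.log_pos one_lt_two).ne'
  unfold lseThreshold
  simp only [Real.logb]
  rw [Real.log_mul (Real.exp_pos 1).ne' (by positivity), Real.log_exp]
  congr 2
  · rw [← mul_div_mul_left _ _ h2]
    congr 1 <;> field_simp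
    ring
  · congr 1
    field_simp

/-- Probabilistic method with all probabilities multiplied by the number `k ^ (n * d)` of outcomes.
Drawing with repetition keeps the draws independent and can only lower the degrees. -/
theorem exists_lse {n k d : ℕ} {β η : ℝ} (hk : 0 < k) (hkn : k ≤ n) (hβ : 0 < β) (hβ1 : β < 1)
    (hb : ∃ b : ℕ, β * k = b) (hη : 0 < η) (hd : lseThreshold n k β η < d) :
    ∃ G : BipGraph n k, IsLSE β η G ∧ (∀ i, (G i).card ≤ d) ∧
      ∀ j, ((G.rightNbrs j).card : ℝ) ≤ 2 * n * d / k := by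
  classical
  obtain ⟨b, hb⟩ := hb
  have hn : 0 < n := hk.trans_le hkn
  have hk' : (0 : ℝ) < k := by exact_mod_cast hk
  have hn' : (0 : ℝ) < n := by exact_mod_cast hn
  have hb0 : 0 < b := by
    have : (0 : ℝ) < b := by rw [← hb]; positivity
    exact_mod_cast this
  have hb' : (0 : ℝ) < b := by exact_mod_cast hb0
  have hbk : b ≤ k := by
    have : (b : ℝ) ≤ k := by rw [← hb]; nlinarith
    exact_mod_cast this
  -- Sets of exactly this size suffice, because a larger set contains one of them and has at least
  -- its neighbours.
  set s := ⌈(n : ℝ) * η⌉₊ with hs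
  have hs0 : 0 < s := Nat.ceil_pos.2 (by positivity)
  have hs' : (0 : ℝ) < s := by exact_mod_cast hs0
  have hs1 : (1 : ℝ) ≤ s := by exact_mod_cast hs0
  have hsη : (n : ℝ) * η ≤ s := Nat.le_ceil _
  rw [lseThreshold_eq hn, max_lt_iff] at hd
  obtain ⟨hd1, hd2⟩ := hd
  have hlb : 0 < Real.log (1 / β) := Real.log_pos (by rw [lt_div_iff₀ hβ]; linarith)
  have hm : 0 < modDensity n η := lt_max_of_lt_left (by positivity)
  -- Both `s ≥ nη` and `s ≥ 1` hold, which is where the modified density enters the threshold.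
  have hns : Real.log ((n : ℝ) / s) ≤ Real.log (1 / modDensity n η) := by
    apply Real.log_le_log (by positivity)
    rw [div_le_div_iff₀ hs' hm, one_mul]
    rcases le_total (1 / (n : ℝ)) η with h | h
    · rw [modDensity, max_eq_right h]; exact hsη
    · rw [modDensity, max_eq_left h, mul_one_div_cancel hn'.ne']; exact hs1
  have hkb : Real.log ((k : ℝ) / b) = Real.log (1 / β) := by
    rw [← hb]; congr 1; field_simp
  have heb : Real.log (Real.exp 1 / β) = 1 + Real.log (1 / β) := by
    rw [div_eq_mul_one_div, Real.log_mul (Real.exp_pos 1).ne' (by positivity), Real.log_exp]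
  -- the union bound over pairs of a large set of bits and a set of `b` machines
  have key1 : (n.choose s : ℝ) * k.choose b * β ^ (s * d) < 1 / 2 := by
    have e1 : β ^ (s * d) = Real.exp (-(s * d * Real.log (1 / β))) := by
      rw [one_div, Real.log_inv, mul_neg, neg_neg]
      have : ((s : ℝ) * d) = ((s * d : ℕ) : ℝ) := by push_cast; ring
      rw [this, Real.exp_nat_mul, Real.exp_log hβ]
    have e2 : (1 / 2 : ℝ) = Real.exp (- Real.log 2) := by
      rw [Real.exp_neg, Real.exp_log two_pos, one_div]
    calc (n.choose s : ℝ) * k.choose b * β ^ (s * d)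
        ≤ Real.exp (s * (1 + Real.log (n / s))) * Real.exp (b * (1 + Real.log (k / b)))
            * Real.exp (-(s * d * Real.log (1 / β))) := by
          rw [e1]
          gcongr
          · exact choose_le_exp hs0 hn
          · exact choose_le_exp hb0 hk
      _ < 1 / 2 := by
          rw [e2, ← Real.exp_add, ← Real.exp_add, hkb]
          apply Real.exp_lt_exp.2
          rw [heb, hb] at hd1
          have h5 : Real.log 2 + 1 + Real.log (1 / modDensity n η)
              + b / (η * n) * (1 + Real.log (1 / β)) < d * Real.log (1 / β) := by
            rw [← div_lt_iff₀ hlb, add_div, mul_div_assoc]; exact hd1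
          have h6 : (s : ℝ) * (Real.log 2 + 1 + Real.log (1 / modDensity n η)
              + b / (η * n) * (1 + Real.log (1 / β))) < s * (d * Real.log (1 / β)) := by
            gcongr
          -- Since `s / (ηn) ≥ 1`, the second summand of the threshold pays for the choice of the
          -- machines.
          have h7 : b * (1 + Real.log (1 / β)) ≤ s * (b / (η * n) * (1 + Real.log (1 / β))) := by
            rw [← mul_assoc]
            gcongr
            rw [← mul_div_assoc, le_div_iff₀ (by positivity)]
            nlinarith
          have h8 : (s : ℝ) * Real.log (n / s) ≤ s * Real.log (1 / modDensity n η) := by gcongr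
          -- The summand `log 2` of the threshold supplies the factor 1/2.
          have h9 : Real.log 2 ≤ s * Real.log 2 :=
            le_mul_of_one_le_left (Real.log_pos one_lt_two).le hs1
          nlinarith
  set bad : Finset (Fin n × Fin d → Fin k) :=
    (Finset.powersetCard s Finset.univ ×ˢ Finset.powersetCard b Finset.univ).biUnion
      fun ST : Finset (Fin n) × Finset (Fin k) =>
        Finset.univ.filter fun ω => ∀ p, p.1 ∈ ST.1 → ω p ∈ ST.2 with hbad
  set crowded : Finset (Fin n × Fin d → Fin k) := Finset.univ.biUnion fun j : Fin k =>
    Finset.univ.filter fun ω =>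
        2 * (n : ℝ) * d / k < (Finset.univ.filter fun p => ω p = j).card with hcr
  have hK : (0 : ℝ) < (k : ℝ) ^ (n * d) := by positivity
  -- The strict inequality here, with `≤` for `crowded`, leaves at least one outcome.
  have c1 : (bad.card : ℝ) < (k : ℝ) ^ (n * d) * (1 / 2) := by
    have : (bad.card : ℝ) ≤ ∑ ST ∈ (Finset.powersetCard s (Finset.univ : Finset (Fin n)) ×ˢ
        Finset.powersetCard b (Finset.univ : Finset (Fin k))),
        (k : ℝ) ^ (n * d) * β ^ (s * d) := by
      refine (Nat.cast_le.2 Finset.card_biUnion_le).trans ?_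
      rw [Nat.cast_sum]
      refine Finset.sum_le_sum fun ST hST => ?_
      rw [Finset.mem_product, Finset.mem_powersetCard, Finset.mem_powersetCard] at hST
      rw [card_draws_subset (β := β) ST.1 ST.2 (by rw [hST.2.2, hb]), hST.1.2]
    refine this.trans_lt ?_
    rw [Finset.sum_const, Finset.card_product, Finset.card_powersetCard,
      Finset.card_powersetCard, Finset.card_univ, Finset.card_univ, Fintype.card_fin,
      Fintype.card_fin, nsmul_eq_mul]
    push_cast
    calc _ = (k : ℝ) ^ (n * d) * ((n.choose s : ℝ) * k.choose b * β ^ (s * d)) := by ring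
      _ < _ := by gcongr
  have c2 : (crowded.card : ℝ) ≤ (k : ℝ) ^ (n * d) * (1 / 2) := by
    refine (Nat.cast_le.2 Finset.card_biUnion_le).trans ?_
    rw [Nat.cast_sum]
    have : ∀ j ∈ (Finset.univ : Finset (Fin k)),
        ((Finset.univ.filter fun ω : Fin n × Fin d → Fin k =>
        2 * (n : ℝ) * d / k < (Finset.univ.filter fun p => ω p = j).card).card : ℝ)
          ≤ (k : ℝ) ^ (n * d) * (1 / (2 * k)) := fun j _ =>
      (card_draws_many_hits_lt hk j (by
        rw [lt_div_iff₀ hk']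
        rw [div_lt_iff₀ hn'] at hd2
        nlinarith)).le
    refine (Finset.sum_le_sum this).trans (le_of_eq ?_)
    rw [Finset.sum_const, Finset.card_univ, Fintype.card_fin, nsmul_eq_mul]
    field_simp
  have hex : ∃ ω, ω ∉ bad ∪ crowded := by
    by_contra! hall
    have h1 : (bad ∪ crowded).card = k ^ (n * d) := by
      rw [Finset.eq_univ_iff_forall.2 hall]
      simp
    have h2 : ((bad ∪ crowded).card : ℝ) ≤ bad.card + crowded.card := by
      exact_mod_cast Finset.card_union_le _ _
    rw [h1] at h2
    push_cast at h2
    linarith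
  obtain ⟨ω, hω⟩ := hex
  rw [Finset.mem_union, not_or] at hω
  refine ⟨BipGraph.ofDraws ω, ?_, BipGraph.card_ofDraws_le ω, fun j => ?_⟩
  · intro S hS
    by_contra! hcon
    apply hω.1
    obtain ⟨S', hS', hcard⟩ := Finset.exists_subset_card_eq (Nat.ceil_le.2 hS)
    rw [hb] at hcon
    have hcon' : ((S.biUnion (BipGraph.ofDraws ω)).card) ≤ b := by exact_mod_cast hcon
    -- A neighbourhood of at most `b` machines is padded to exactly `b`, so that the pair is one of
    -- those counted in `bad`.
    obtain ⟨T, hT, hTcard⟩ := Finset.exists_superset_card_eq hcon' (by simpa using hbk)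
    rw [hbad, Finset.mem_biUnion]
    refine ⟨(S', T), ?_, ?_⟩
    · simp [hcard, hTcard, hs]
    · simp only [Finset.mem_filter, Finset.mem_univ, true_and]
      intro p hp
      apply hT
      rw [Finset.mem_biUnion]
      exact ⟨p.1, hS' hp, by simp only [BipGraph.ofDraws, Finset.mem_image]; exact ⟨p.2, by simp⟩⟩
  · refine (Nat.cast_le.2 (BipGraph.card_rightNbrs_ofDraws_le ω j)).trans ?_
    by_contra! hcon
    exact hω.2 (Finset.mem_biUnion.2 ⟨j, Finset.mem_univ _, by simpa using hcon⟩)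

theorem exists_lseFamily {n k : ℕ} {β : ℝ} (hk : 0 < k) (hkn : k ≤ n) (hβ : 0 < β) (hβ1 : β < 1)
    (hb : ∃ b : ℕ, β * k = b) : ∃ G : ℕ → BipGraph n k, IsLSEFamily β G := by
  have h : ∀ r : ℕ, ∃ G : BipGraph n k, IsLSE β (1 / 2 ^ r) G ∧
      (∀ i, (G i).card ≤ lseDegree n k β (1 / 2 ^ r)) ∧
      ∀ j, ((G.rightNbrs j).card : ℝ) ≤ 2 * n * lseDegree n k β (1 / 2 ^ r) / k := fun r =>
    exists_lse hk hkn hβ hβ1 hb (by positivity)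
      (by unfold lseDegree; push_cast; exact Nat.lt_floor_add_one _)
  choose G hG using h
  exact ⟨G, fun r _ => hG r⟩

/-! ### Runs of the algorithm -/

section Dynamics

variable {n k : ℕ} (G : ℕ → BipGraph n k) (A : CCAAdversary n k)

/-- State of machine `l` after `t` rounds of the algorithm. -/
abbrev lseRun (t : ℕ) (l : Fin k) : LSEState n k := (lseDisjunct1 G).state A t l

/-- State of a running machine `l` after the query sub-round. -/
def lseAnswered (l : Fin k) (s : LSEState n k) : LSEState n k :=
  s.absorb fun x => if x ∈ s.queries G l then some (A.input x) else none

/-- The messages delivered to machine `l` in round `t`. -/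
def lseMail (t : ℕ) (l j : Fin k) : Option (Fin n) :=
  if j ∈ A.byz then A.byzMsg t j l else (lseDisjunct1 G).roundMessages A j (lseRun G A t j) l

theorem lseRun_zero (l : Fin k) : lseRun G A 0 l = (lseDisjunct1 G).init l := rfl

variable {G A}

theorem lseRun_succ_of_isSome {t : ℕ} {l : Fin k} (h : (lseRun G A t l).out.isSome) :
    lseRun G A (t + 1) l = lseRun G A t l :=
  if_pos h

theorem lseRun_succ_of_none {t : ℕ} {l : Fin k} (h : (lseRun G A t l).out = none) :
    lseRun G A (t + 1) l
      = (lseAnswered G A l (lseRun G A t l)).receive (lseMail G A t l) := by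
  have h' : ¬ (lseRun G A t l).out.isSome := by simp [h]
  exact (if_neg h').trans
    (congrArg (fun s : LSEState n k => s.receive (lseMail G A t l)) (if_neg h'))

theorem lseMail_of_none {t : ℕ} {l j : Fin k} (hj : j ∉ A.byz) (hl : l ≠ j)
    (h : (lseRun G A t j).out = none) :
    lseMail G A t l j = (lseAnswered G A j (lseRun G A t j)).announce := by
  rw [lseMail, if_neg hj]
  change (if ((lseRun G A t j).out).isSome then none else if l = j then none else
    LSEState.announce (if ((lseRun G A t j).out).isSome then _ else _)) = _
  have h' : ¬ (lseRun G A t j).out.isSome := by simp [h]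
  rw [if_neg h', if_neg hl]
  exact congrArg LSEState.announce (if_neg h')

theorem lseMail_eq_some {t : ℕ} {l j : Fin k} {x : Fin n} (hj : j ∉ A.byz)
    (h : lseMail G A t l j = some x) :
    (lseRun G A t j).out = none ∧
      (lseAnswered G A j (lseRun G A t j)).announce = some x := by
  have h0 : (lseRun G A t j).out = none := by
    by_contra hne
    have : lseMail G A t l j = none := by
      rw [lseMail, if_neg hj]
      exact if_pos (Option.isSome_iff_ne_none.2 hne)
    simp [this] at h
  refine ⟨h0, ?_⟩
  by_cases hl : l = j
  · have : lseMail G A t l j = none := by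
      rw [lseMail, if_neg hj]
      change (if ((lseRun G A t j).out).isSome then none else if l = j then none else _) = _
      rw [if_neg (by simp [h0]), if_pos hl]
    simp [this] at h
  · rw [← lseMail_of_none hj hl h0, h]

/-! ### The fields of a state after each half of a round -/

@[simp] theorem LSEState.receive_out (s : LSEState n k) (m) : (s.receive m).out = s.out := by
  unfold LSEState.receive; split_ifs <;> rfl

@[simp] theorem LSEState.receive_res (s : LSEState n k) (m) : (s.receive m).res = s.res := by
  unfold LSEState.receive; split_ifs <;> rfl

@[simp] theorem LSEState.receive_blacklist (s : LSEState n k) (m) :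
    (s.receive m).blacklist = s.blacklist := by
  unfold LSEState.receive; split_ifs <;> rfl

@[simp] theorem LSEState.receive_round (s : LSEState n k) (m) :
    (s.receive m).round = s.round + 1 := by
  unfold LSEState.receive; split_ifs <;> rfl

@[simp] theorem lseAnswered_round (l : Fin k) (s : LSEState n k) :
    (lseAnswered G A l s).round = s.round := by
  unfold lseAnswered LSEState.absorb; dsimp only; split_ifs <;> rfl

@[simp] theorem lseAnswered_prevInbox (l : Fin k) (s : LSEState n k) :
    (lseAnswered G A l s).prevInbox = s.prevInbox := by
  unfold lseAnswered LSEState.absorb; dsimp only; split_ifs <;> rfl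

theorem lseAnswered_res (l : Fin k) (s : LSEState n k) (x : Fin n) :
    (lseAnswered G A l s).res x
      = if x ∈ s.queries G l then some (A.input x) else s.res x := by
  have : (lseAnswered G A l s).res x
      = (if x ∈ s.queries G l then some (A.input x) else none).or (s.res x) := by
    unfold lseAnswered LSEState.absorb
    by_cases hr : s.round < 2 * Nat.clog 2 n <;> simp only [hr, if_true, if_false]
  rw [this]; split_ifs <;> simp

theorem lseAnswered_announce (l : Fin k) (s : LSEState n k) :
    (lseAnswered G A l s).announce = if s.round < 2 * Nat.clog 2 n then
      (List.finRange n).find? fun i => decide ((lseAnswered G A l s).res i = some true)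
      else none := by
  unfold lseAnswered LSEState.absorb; dsimp only; split_ifs <;> rfl

theorem lseAnswered_out_of_lt {l : Fin k} {s : LSEState n k} (h : s.round < 2 * Nat.clog 2 n) :
    (lseAnswered G A l s).out
      = if (lseAnswered G A l s).announce.isSome then some true else none := by
  unfold lseAnswered LSEState.absorb; dsimp only; rw [if_pos h]

theorem lseAnswered_out_of_not_lt {l : Fin k} {s : LSEState n k}
    (h : ¬ s.round < 2 * Nat.clog 2 n) :
    (lseAnswered G A l s).out
      = if ∀ i, (lseAnswered G A l s).res i = some false then some false else some true := by
  unfold lseAnswered LSEState.absorb; dsimp only; rw [if_neg h]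

theorem lseAnswered_blacklist (l : Fin k) (s : LSEState n k) :
    (lseAnswered G A l s).blacklist =
      if s.round < 2 * Nat.clog 2 n ∧ ¬ Even s.round then
        s.blacklist ∪ Finset.univ.filter
          fun j => ∃ i ∈ s.claims j, (lseAnswered G A l s).res i = some false
      else s.blacklist := by
  unfold lseAnswered LSEState.absorb; dsimp only
  by_cases h : s.round < 2 * Nat.clog 2 n <;> by_cases h2 : Even s.round <;> simp [h, h2]

theorem LSEState.mem_claims {s : LSEState n k} {j : Fin k} {x : Fin n} :
    x ∈ s.claims j ↔ s.inbox j = some x ∨ s.prevInbox j = some x := by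
  simp [LSEState.claims]

theorem LSEState.mem_queries_of_claim {s : LSEState n k} {l j : Fin k} {x : Fin n}
    (h : s.round < 2 * Nat.clog 2 n) (ho : ¬ Even s.round) (hj : j ∉ s.blacklist)
    (hx : x ∈ s.claims j) : x ∈ s.queries G l := by
  rw [LSEState.queries, if_pos h, if_neg ho, List.mem_flatMap]
  exact ⟨j, by simp [hj], hx⟩

/-- Invariants of the state of a machine after `t` rounds. -/
structure LSEInvariant (A : CCAAdversary n k) (t : ℕ) (s : LSEState n k) : Prop where
  res_eq : ∀ x b, s.res x = some b → A.input x = b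
  round_eq : s.out = none → s.round = t
  le_of_none : s.out = none → t ≤ 2 * Nat.clog 2 n
  honest_notMem : ∀ j ∉ A.byz, j ∉ s.blacklist
  claims_true : ∀ j ∉ A.byz, ∀ x ∈ s.claims j, A.input x = true
  out_eq : ∀ b, s.out = some b → b = decide (∃ x, A.input x = true)

theorem LSEInvariant.answered_res {t : ℕ} {s : LSEState n k} (h : LSEInvariant A t s)
    (l : Fin k) {x : Fin n} {b : Bool} (hx : (lseAnswered G A l s).res x = some b) :
    A.input x = b := by
  rw [lseAnswered_res] at hx
  split_ifs at hx
  · simpa using hx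
  · exact h.res_eq x b hx

theorem LSEInvariant.input_of_announce {t : ℕ} {s : LSEState n k} (h : LSEInvariant A t s)
    (l : Fin k) {x : Fin n} (hx : (lseAnswered G A l s).announce = some x) :
    A.input x = true := by
  rw [lseAnswered_announce] at hx
  split_ifs at hx
  have := List.find?_some hx
  exact h.answered_res l (by simpa using this)

theorem LSEInvariant.answered_out {t : ℕ} {s : LSEState n k} (h : LSEInvariant A t s)
    (l : Fin k) {b : Bool} (hb : (lseAnswered G A l s).out = some b) :
    b = decide (∃ x, A.input x = true) := by
  by_cases hr : s.round < 2 * Nat.clog 2 n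
  · rw [lseAnswered_out_of_lt hr] at hb
    split_ifs at hb with hs
    obtain ⟨x, hx⟩ := Option.isSome_iff_exists.1 hs
    have : ∃ x, A.input x = true := ⟨x, h.input_of_announce l hx⟩
    simp only [Option.some.injEq] at hb
    simp [← hb, this]
  · rw [lseAnswered_out_of_not_lt hr] at hb
    have hres : ∀ x, (lseAnswered G A l s).res x = some (A.input x) := by
      intro x
      rw [lseAnswered_res, if_pos]
      rw [LSEState.queries, if_neg hr]
      exact List.mem_finRange x
    simp only [hres, Option.some.injEq] at hb
    split_ifs at hb with hs <;> simp only [Option.some.injEq] at hb <;> subst hb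
    · simp [hs]
    · push Not at hs
      simpa using hs

theorem lseAnswered_out_isSome_of_mem {l : Fin k} {s : LSEState n k} {x : Fin n}
    (hr : s.round < 2 * Nat.clog 2 n) (hq : x ∈ s.queries G l) (hx : A.input x = true) :
    (lseAnswered G A l s).out.isSome := by
  have : (lseAnswered G A l s).announce.isSome := by
    rw [lseAnswered_announce, if_pos hr, List.find?_isSome]
    exact ⟨x, List.mem_finRange x, by simp [lseAnswered_res, hq, hx]⟩
  rw [lseAnswered_out_of_lt hr, if_pos this]
  rfl

theorem lseInvariant_init (l : Fin k) : LSEInvariant A 0 (lseRun G A 0 l) where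
  res_eq := by simp [lseRun_zero, lseDisjunct1]
  round_eq := fun _ => rfl
  le_of_none := fun _ => Nat.zero_le _
  honest_notMem := by simp [lseRun_zero, lseDisjunct1]
  claims_true := by simp [lseRun_zero, lseDisjunct1, LSEState.claims]
  out_eq := by simp [lseRun_zero, lseDisjunct1]

/-- The induction treats all machines at once: the truth of what `l` receives from an honest `j` is
the invariant of `j` one round earlier. -/
theorem lseInvariant (t : ℕ) : ∀ l : Fin k, LSEInvariant A t (lseRun G A t l) := by
  induction t with
  | zero => exact lseInvariant_init
  | succ t ih =>
    intro l
    have h := ih l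
    by_cases ho : (lseRun G A t l).out = none
    swap
    · rw [lseRun_succ_of_isSome (Option.isSome_iff_ne_none.2 ho)]
      exact ⟨h.res_eq, fun h' => absurd h' ho, fun h' => absurd h' ho, h.honest_notMem,
        h.claims_true, h.out_eq⟩
    rw [lseRun_succ_of_none ho]
    have hround := h.round_eq ho
    refine ⟨fun x b hx => ?_, fun _ => ?_, fun hn => ?_, fun j hj => ?_, fun j hj x hx => ?_,
      fun b hb => ?_⟩
    · rw [LSEState.receive_res] at hx
      exact h.answered_res l hx
    · simp [hround]
    · rw [LSEState.receive_out] at hn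
      -- In the final round a machine always returns, so one still running must have been before it.
      by_contra hlt
      have hr : ¬ (lseRun G A t l).round < 2 * Nat.clog 2 n := by omega
      rw [lseAnswered_out_of_not_lt hr] at hn
      split_ifs at hn
    · rw [LSEState.receive_blacklist, lseAnswered_blacklist]
      split_ifs
      · rw [Finset.mem_union, not_or]
        refine ⟨h.honest_notMem j hj, ?_⟩
        simp only [Finset.mem_filter, Finset.mem_univ, true_and, not_exists, not_and]
        intro x hx hres
        -- Blacklisting `j` would need a claim read as `0`, but honest claims are true.
        have h1 := h.claims_true j hj x hx
        rw [h.answered_res l hres] at h1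
        exact Bool.noConfusion h1
      · exact h.honest_notMem j hj
    · have hmail : lseMail G A t l j = some x → A.input x = true := fun hm =>
        (ih j).input_of_announce j (lseMail_eq_some hj hm).2
      have hold := h.claims_true j hj x
      rw [LSEState.mem_claims] at hold hx
      unfold LSEState.receive at hx
      -- After an even round `prevInbox` survives and `inbox` is new; after an odd one `inbox` is
      -- emptied and the new mail becomes `prevInbox`.
      split_ifs at hx
      · rcases hx with hx | hx
        · exact hmail hx
        · exact hold (Or.inr (by simpa using hx))
      · rcases hx with hx | hx
        · simp at hx
        · exact hmail hx
    · rw [LSEState.receive_out] at hb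
      exact h.answered_out l hb

/-! ### Termination and correctness -/

theorem lseRun_out_mono {t u : ℕ} {l : Fin k} (htu : t ≤ u) (h : (lseRun G A t l).out.isSome) :
    (lseRun G A u l).out.isSome := by
  induction u, htu using Nat.le_induction with
  | base => exact h
  | succ u _ ih => rw [lseRun_succ_of_isSome ih]; exact ih

theorem lseRun_out_isSome_final (l : Fin k) :
    (lseRun G A (2 * Nat.clog 2 n + 1) l).out.isSome := by
  by_contra hne
  have := (lseInvariant (G := G) (A := A) (2 * Nat.clog 2 n + 1) l).le_of_none (by simpa using hne)
  omega

theorem lseDisjunct1_solves : (lseDisjunct1 G).SolvesDisjunction A := by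
  intro l _
  refine ⟨2 * Nat.clog 2 n + 1, ?_⟩
  obtain ⟨b, hb⟩ := Option.isSome_iff_exists.1 (lseRun_out_isSome_final (G := G) (A := A) l)
  rw [← (lseInvariant _ l).out_eq b hb]
  exact hb

theorem lseRoundComplexity_le {T : ℕ} (h : ∀ l ∉ A.byz, (lseRun G A T l).out.isSome) :
    (lseDisjunct1 G).roundComplexity A ≤ T :=
  Nat.sInf_le h

/-! ### Number of queries -/

/-- The queries of machine `l` in round `t`, apart from those verifying claims of others. -/
def ownQueries (G : ℕ → BipGraph n k) (l : Fin k) (t : ℕ) : ℕ :=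
  if t < 2 * Nat.clog 2 n then
    if Even t then ((G (t / 2 + 1)).rightNbrs l).card else 0
  else n

theorem length_claims_le (s : LSEState n k) (j : Fin k) : (s.claims j).length ≤ 2 := by
  unfold LSEState.claims
  cases s.inbox j <;> cases s.prevInbox j <;> simp

/-- The factor 2 counts one claim per sender from each of the two boxes, `inbox` and `prevInbox`. -/
theorem length_queries_le (l : Fin k) (s : LSEState n k) :
    (s.queries G l).length ≤ ownQueries G l s.round +
      if s.round < 2 * Nat.clog 2 n ∧ ¬ Even s.round then
        2 * (Finset.univ.filter fun j => j ∉ s.blacklist ∧ s.claims j ≠ []).card else 0 := by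
  unfold LSEState.queries ownQueries
  by_cases h : s.round < 2 * Nat.clog 2 n
  swap
  · simp [h]
  by_cases h2 : Even s.round
  · simp only [h, h2, if_true, not_true, and_false, if_false, add_zero]
    rw [← List.toFinset_card_of_nodup ((List.nodup_finRange n).filter _)]
    apply Finset.card_le_card
    intro x
    simp
  · simp only [h, h2, if_true, if_false, not_false_eq_true, and_self, zero_add]
    rw [List.length_flatMap, ← List.sum_toFinset _ ((List.nodup_finRange k).filter _)]
    rw [Finset.card_filter, Finset.mul_sum]
    rw [← Finset.sum_subset (Finset.subset_univ ((List.filter (fun j => decide (j ∉ s.blacklist))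
      (List.finRange k)).toFinset))]
    · refine Finset.sum_le_sum fun j hj => ?_
      have hj' : j ∉ s.blacklist := by simpa using hj
      by_cases hc : s.claims j = []
      · simp [hc]
      · simp [hj', hc, length_claims_le]
    · intro j _ hj
      have hj' : j ∈ s.blacklist := by simpa using hj
      simp [hj']

/-- Unless a set bit is found, every machine whose claims are verified becomes blacklisted. -/
theorem card_blacklist_answered (l : Fin k) (s : LSEState n k)
    (hr : s.round < 2 * Nat.clog 2 n) (ho : ¬ Even s.round)
    (hout : (lseAnswered G A l s).out = none) :
    s.blacklist.card + (Finset.univ.filter fun j => j ∉ s.blacklist ∧ s.claims j ≠ []).card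
      ≤ (lseAnswered G A l s).blacklist.card := by
  rw [← Finset.card_union_of_disjoint]
  · apply Finset.card_le_card
    rw [lseAnswered_blacklist, if_pos ⟨hr, ho⟩]
    apply Finset.union_subset_union_right
    intro j
    simp only [Finset.mem_filter, Finset.mem_univ, true_and]
    rintro ⟨hj, hc⟩
    obtain ⟨x, hx⟩ := List.exists_mem_of_ne_nil _ hc
    refine ⟨x, hx, ?_⟩
    have hq := LSEState.mem_queries_of_claim (G := G) (l := l) hr ho hj hx
    rw [lseAnswered_res, if_pos hq]
    cases hi : A.input x
    · rfl
    · have := lseAnswered_out_isSome_of_mem (A := A) hr hq hi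
      simp [hout] at this
  · rw [Finset.disjoint_right]
    intro j hj
    simp only [Finset.mem_filter, Finset.mem_univ, true_and] at hj
    exact hj.1

/-- Amortisation: as long as the machine runs, every sender it has checked is now blacklisted and is
never checked again, so two queries are charged to each blacklisted machine. The second conjunct
carries the induction; the first also covers the round of return, in which truthful senders are
checked without being blacklisted. -/
theorem sum_lseQueries_le (l : Fin k) (t : ℕ) :
    (∑ u ∈ Finset.range t, ((lseDisjunct1 G).roundQueries l (lseRun G A u l)).length
      ≤ ∑ u ∈ Finset.range t, ownQueries G l u + 2 * k) ∧
    ((lseRun G A t l).out = none →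
      ∑ u ∈ Finset.range t, ((lseDisjunct1 G).roundQueries l (lseRun G A u l)).length
        ≤ ∑ u ∈ Finset.range t, ownQueries G l u + 2 * (lseRun G A t l).blacklist.card) := by
  induction t with
  | zero => simp
  | succ t ih =>
    rw [Finset.sum_range_succ, Finset.sum_range_succ]
    by_cases ho : (lseRun G A t l).out = none
    swap
    · have hs := Option.isSome_iff_ne_none.2 ho
      have : (lseDisjunct1 G).roundQueries l (lseRun G A t l) = [] := if_pos hs
      rw [lseRun_succ_of_isSome hs, this]
      exact ⟨by simpa using by omega, fun h => absurd h ho⟩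
    have hq : (lseDisjunct1 G).roundQueries l (lseRun G A t l)
        = (lseRun G A t l).queries G l :=
      if_neg (by change ¬ ((lseRun G A t l).out).isSome = true; simp [ho])
    have hlen := length_queries_le (G := G) l (lseRun G A t l)
    have hround := (lseInvariant (G := G) (A := A) t l).round_eq ho
    have ih2 := ih.2 ho
    rw [hq, lseRun_succ_of_none ho]
    set s := lseRun G A t l with hs
    rw [LSEState.receive_out, LSEState.receive_blacklist, ← hround]
    rw [← hround] at ih2
    -- Even in the round of return the senders checked lie outside the blacklist, so the charges
    -- stay within `2 * k`.
    have hdisj : s.blacklist.card +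
        (Finset.univ.filter fun j => j ∉ s.blacklist ∧ s.claims j ≠ []).card ≤ k := by
      rw [← Finset.card_union_of_disjoint]
      · simpa using Finset.card_le_univ (s.blacklist ∪ _)
      · rw [Finset.disjoint_right]
        intro j hj
        simp only [Finset.mem_filter, Finset.mem_univ, true_and] at hj
        exact hj.1
    constructor
    · split_ifs at hlen <;> omega
    · intro hout
      by_cases hc : s.round < 2 * Nat.clog 2 n ∧ ¬ Even s.round
      · have := card_blacklist_answered l s hc.1 hc.2 hout
        rw [if_pos hc] at hlen
        omega
      · rw [if_neg hc] at hlen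
        rw [lseAnswered_blacklist, if_neg hc]
        omega

theorem lseQueryComplexity_le {T B : ℕ}
    (hT : (lseDisjunct1 G).roundComplexity A ≤ T)
    (hB : ∀ l, ∑ u ∈ Finset.range T, ownQueries G l u ≤ B) :
    (lseDisjunct1 G).queryComplexity A ≤ B + 2 * k := by
  refine Finset.sup_le fun l _ => ?_
  refine (sum_lseQueries_le (G := G) (A := A) l _).1.trans ?_
  have : ∑ u ∈ Finset.range ((lseDisjunct1 G).roundComplexity A), ownQueries G l u
      ≤ ∑ u ∈ Finset.range T, ownQueries G l u :=
    Finset.sum_le_sum_of_subset (Finset.range_mono hT)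
  have := hB l
  omega

theorem sum_ownQueries_two_mul (l : Fin k) {R : ℕ} (hR : R ≤ Nat.clog 2 n) :
    ∑ u ∈ Finset.range (2 * R), ownQueries G l u
      = ∑ r ∈ Finset.range R, ((G (r + 1)).rightNbrs l).card := by
  induction R with
  | zero => simp
  | succ R ih =>
    rw [Finset.sum_range_succ, ← ih (by omega), show 2 * (R + 1) = 2 * R + 1 + 1 by ring,
      Finset.sum_range_succ, Finset.sum_range_succ, add_assoc]
    congr 1
    have h1 : 2 * R < 2 * Nat.clog 2 n := by omega
    have h2 : 2 * R + 1 < 2 * Nat.clog 2 n := by omega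
    simp [ownQueries, h1, h2]

/-! ### Early termination -/

/-- If an honest machine returns in round `t`, before the final round, then every other honest
machine that is still running receives the index of a set bit from it. -/
theorem exists_lseMail_of_return {t : ℕ} {l j : Fin k} (hj : j ∉ A.byz) (hl : l ≠ j)
    (ht : t < 2 * Nat.clog 2 n) (h0 : (lseRun G A t j).out = none)
    (h1 : (lseRun G A (t + 1) j).out.isSome) : ∃ x, lseMail G A t l j = some x := by
  rw [lseMail_of_none hj hl h0]
  rw [lseRun_succ_of_none h0, LSEState.receive_out,
    lseAnswered_out_of_lt (by rwa [(lseInvariant t j).round_eq h0])] at h1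
  split_ifs at h1 with h2
  · exact Option.isSome_iff_exists.1 h2
  · simp at h1

/-- An honest sender is never blacklisted and its claim is true, so the verifying query finds a one.
-/
theorem lseRun_out_of_honest_claim {t : ℕ} {l j : Fin k} {x : Fin n} (hj : j ∉ A.byz)
    (ht : t < 2 * Nat.clog 2 n) (ho : ¬ Even t) (hx : x ∈ (lseRun G A t l).claims j) :
    (lseRun G A (t + 1) l).out.isSome := by
  by_cases h0 : (lseRun G A t l).out = none
  swap
  · exact lseRun_out_mono (Nat.le_succ t) (Option.isSome_iff_ne_none.2 h0)
  have inv := lseInvariant (G := G) (A := A) t l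
  have hr := inv.round_eq h0
  rw [← hr] at ht ho
  rw [lseRun_succ_of_none h0, LSEState.receive_out]
  exact lseAnswered_out_isSome_of_mem ht
    (LSEState.mem_queries_of_claim ht ho (inv.honest_notMem j hj) hx) (inv.claims_true j hj x hx)

/-- A return of an honest machine in one of the first `2R - 1` rounds makes all honest machines
return within `2R` rounds. -/
theorem lseRun_out_of_return {R u : ℕ} {l j : Fin k} (hR : R ≤ Nat.clog 2 n) (hj : j ∉ A.byz)
    (hu : u + 2 ≤ 2 * R) (h0 : (lseRun G A u j).out = none)
    (h1 : (lseRun G A (u + 1) j).out.isSome) : (lseRun G A (2 * R) l).out.isSome := by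
  by_cases hl : l = j
  · exact lseRun_out_mono (by omega) (hl ▸ h1)
  obtain ⟨x, hx⟩ := exists_lseMail_of_return hj hl (by omega) h0 h1
  by_cases hul : (lseRun G A u l).out = none
  swap
  · exact lseRun_out_mono (by omega) (Option.isSome_iff_ne_none.2 hul)
  have hround := (lseInvariant (G := G) (A := A) u l).round_eq hul
  have hsucc := lseRun_succ_of_none hul
  -- Mail of an even round is verified in the next round. Mail of an odd round waits in `prevInbox`
  -- during round `u + 1` and is verified in round `u + 2`; parity excludes `u + 2 = 2 * R`, so this
  -- still precedes the end of phase `R`.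
  by_cases he : Even u
  · refine lseRun_out_mono (t := u + 1 + 1) (by omega)
      (lseRun_out_of_honest_claim hj (x := x) (by grind) (by grind) ?_)
    rw [hsucc, LSEState.mem_claims, LSEState.receive,
      if_pos (by rwa [lseAnswered_round, hround])]
    exact Or.inl hx
  · have hne : u + 2 ≠ 2 * R := by grind
    by_cases hul' : (lseRun G A (u + 1) l).out = none
    swap
    · exact lseRun_out_mono (by omega) (Option.isSome_iff_ne_none.2 hul')
    have hround' := (lseInvariant (G := G) (A := A) (u + 1) l).round_eq hul'
    refine lseRun_out_mono (t := u + 1 + 1 + 1) (by omega)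
      (lseRun_out_of_honest_claim hj (x := x) (by grind) (by grind) ?_)
    rw [lseRun_succ_of_none hul', LSEState.mem_claims, LSEState.receive,
      if_pos (by rw [lseAnswered_round, hround']; grind)]
    right
    change (lseAnswered G A l (lseRun G A (u + 1) l)).prevInbox j = some x
    rw [lseAnswered_prevInbox, hsucc, LSEState.receive,
      if_neg (by rwa [lseAnswered_round, hround])]
    exact hx

theorem lseRun_out_of_neighbour {R : ℕ} {j : Fin k} {x : Fin n} (hR : R < Nat.clog 2 n)
    (hx : A.input x = true) (hj : j ∈ G (R + 1) x) :
    (lseRun G A (2 * R + 1) j).out.isSome := by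
  by_cases h0 : (lseRun G A (2 * R) j).out = none
  swap
  · exact lseRun_out_mono (Nat.le_succ _) (Option.isSome_iff_ne_none.2 h0)
  have hr := (lseInvariant (G := G) (A := A) (2 * R) j).round_eq h0
  have hlt : (lseRun G A (2 * R) j).round < 2 * Nat.clog 2 n := by omega
  rw [lseRun_succ_of_none h0, LSEState.receive_out]
  refine lseAnswered_out_isSome_of_mem hlt ?_ hx
  rw [LSEState.queries, if_pos hlt, if_pos (by simp [hr]), hr]
  simp [BipGraph.rightNbrs, hj]

/-- If the set of ones has more than `βk` neighbours in `G R`, all honest machines return by the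
end of phase `R`. -/
theorem lseRun_out_of_isLSE {β : ℝ} {R : ℕ} (hR0 : 0 < R) (hR : R ≤ Nat.clog 2 n)
    (hG : IsLSE β (1 / 2 ^ R) (G R)) (hA : (A.byz.card : ℝ) ≤ β * k)
    (hc : (n : ℝ) * (1 / 2 ^ R) ≤ (Finset.univ.filter fun x => A.input x = true).card)
    (l : Fin k) : (lseRun G A (2 * R) l).out.isSome := by
  -- There are more neighbours than Byzantine machines, so one neighbour `j` is honest.
  have h1 := hA.trans_lt (hG _ hc)
  obtain ⟨j, hj, hjb⟩ := Finset.exists_mem_notMem_of_card_lt_card (Nat.cast_lt.1 h1)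
  rw [Finset.mem_biUnion] at hj
  obtain ⟨x, hx, hjx⟩ := hj
  have hx' : A.input x = true := by simpa using hx
  obtain ⟨R, rfl⟩ := Nat.exists_eq_add_of_le' hR0
  have h2 := lseRun_out_of_neighbour (G := G) (by omega) hx' hjx
  -- The machine `j` may have returned in an earlier phase. What counts is its first returning
  -- round, since that is when it announces an index.
  have hex : ∃ u, (lseRun G A u j).out.isSome := ⟨_, h2⟩
  classical
  have hmin := Nat.find_min' hex h2
  have hspec := Nat.find_spec hex
  obtain ⟨u, hu⟩ := Nat.exists_eq_succ_of_ne_zero (n := Nat.find hex) (by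
    intro h0
    rw [h0] at hspec
    simp [lseRun_zero, lseDisjunct1] at hspec)
  have h3 := Nat.find_min hex (m := u) (by omega)
  rw [hu] at hspec hmin
  exact lseRun_out_of_return hR hjb (by omega) (by simpa using h3) hspec

/-! ### Number of messages -/

/-- The crude count of `k * k` sender-recipient pairs per round is enough. -/
theorem lseMessageComplexity_le :
    (lseDisjunct1 G).messageComplexity A ≤ (lseDisjunct1 G).roundComplexity A * (k * k) := by
  unfold CCAProtocol.messageComplexity
  refine (Finset.sum_le_card_nsmul _ _ (k * k) fun t _ => ?_).trans (by simp)
  refine (Finset.sum_le_card_nsmul _ _ k fun i _ => ?_).trans ?_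
  · simpa using Finset.card_le_univ
      (Finset.univ.filter fun j => ((lseDisjunct1 G).roundMessages A i
        ((lseDisjunct1 G).state A t i) j).isSome)
  · rw [smul_eq_mul]
    exact Nat.mul_le_mul_right _ (by simpa using Finset.card_le_univ A.byzᶜ)

end Dynamics

/-! ### Estimates -/

/-- The maximum in the threshold is replaced by a sum. The term growing like `2 ^ r` is kept apart,
because summed over the phases it is geometric, whereas the rest is bounded independently of `r`. -/
theorem lseDegree_le {n k : ℕ} {β D : ℝ} {r : ℕ} (hk : 2 ≤ k) (hkn : k ≤ n) (hβ : 0 < β)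
    (hβ1 : β < 1) (hD : 0 < D) (hD1 : D ≤ 1) (hr : (2 : ℝ) ^ r ≤ 2 / D) :
    2 * (n : ℝ) * lseDegree n k β (1 / 2 ^ r) / k
      ≤ 14 * ((n : ℝ) / k * (Real.logb (1 / β) (Real.exp 1 ^ 2 * (1 / D)) + Real.logb 2 k))
        + 2 * (β * Real.logb (1 / β) (Real.exp 1 / β)) * 2 ^ r := by
  have hk2 : (2 : ℝ) ≤ k := by exact_mod_cast hk
  have hk0 : (0 : ℝ) < k := by linarith
  have hkn' : (k : ℝ) ≤ n := by exact_mod_cast hkn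
  have hn0 : (0 : ℝ) < n := by linarith
  have hlb : 0 < Real.log (1 / β) := Real.log_pos (by rw [lt_div_iff₀ hβ]; linarith)
  have hl2 : 0 < Real.log 2 := Real.log_pos one_lt_two
  have hl2' : Real.log 2 < 1 := Real.log_two_lt_d9.trans (by norm_num)
  have hlD : 0 ≤ Real.log (1 / D) := Real.log_nonneg (by rwa [le_div_iff₀ hD, one_mul])
  have hX : Real.logb (1 / β) (Real.exp 1 ^ 2 * (1 / D))
      = (2 + Real.log (1 / D)) / Real.log (1 / β) := by
    rw [Real.logb, Real.log_mul (by positivity) (by positivity), Real.log_pow, Real.log_exp]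
    norm_num
  have hK : 1 ≤ Real.logb 2 k := by
    rw [Real.le_logb_iff_rpow_le one_lt_two hk0, Real.rpow_one]; exact hk2
  have hKlog : Real.log k ≤ Real.logb 2 k := by
    rw [Real.logb, le_div_iff₀ hl2]
    nlinarith [Real.log_nonneg (show (1 : ℝ) ≤ k by linarith)]
  have hlog2k : Real.log (2 * k) ≤ 2 * Real.logb 2 k := by
    rw [Real.log_mul two_ne_zero hk0.ne']
    linarith
  have hlog2k0 : 0 ≤ Real.log (2 * k) := Real.log_nonneg (by linarith)
  set X := Real.logb (1 / β) (Real.exp 1 ^ 2 * (1 / D)) with hXdef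
  set K := Real.logb 2 k with hKdef
  set L := Real.logb (1 / β) (Real.exp 1 / β) with hLdef
  have hL0 : 0 ≤ L := by
    rw [hLdef, Real.logb]
    apply div_nonneg _ hlb.le
    apply Real.log_nonneg
    rw [le_div_iff₀ hβ]
    linarith [Real.add_one_le_exp 1]
  have hX0 : 0 ≤ X := by rw [hX]; positivity
  have hm : 0 < modDensity n (1 / 2 ^ r) := lt_max_of_lt_right (by positivity)
  -- Only phases with `2 ^ r ≤ 2 / D` are considered, so the phase parameter may be traded for `D`
  -- at the cost of `log 2`.
  have hmlog : Real.log (1 / modDensity n (1 / 2 ^ r)) ≤ Real.log 2 + Real.log (1 / D) := by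
    rw [← Real.log_mul two_ne_zero (by positivity), mul_one_div]
    apply Real.log_le_log (by positivity)
    refine le_trans ?_ hr
    rw [div_le_iff₀ hm]
    have : (1 / 2 ^ r : ℝ) ≤ modDensity n (1 / 2 ^ r) := le_max_right _ _
    calc (1 : ℝ) = 2 ^ r * (1 / 2 ^ r) := by field_simp
      _ ≤ _ := by gcongr
  have hfirst : (Real.log 2 + 1 + Real.log (1 / modDensity n (1 / 2 ^ r))) / Real.log (1 / β)
      ≤ 2 * X := by
    rw [hX, ← mul_div_assoc]
    gcongr
    linarith
  have hth : lseThreshold n k β (1 / 2 ^ r)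
      ≤ 2 * X + β * k / n * L * 2 ^ r + 3 * k * Real.log (2 * k) / n := by
    have hthird : 0 ≤ 3 * k * Real.log (2 * k) / n := by positivity
    have hsecond : β * k / (1 / 2 ^ r * n) * (Real.log (Real.exp 1 / β) / Real.log (1 / β))
        = β * k / n * L * 2 ^ r := by
      rw [hLdef, Real.logb]; field_simp
    rw [lseThreshold_eq (by exact_mod_cast hn0), hsecond]
    apply max_le
    · linarith
    · have : 0 ≤ β * k / n * L * 2 ^ r := by positivity
      linarith
  have hth0 : 0 ≤ lseThreshold n k β (1 / 2 ^ r) := by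
    refine le_trans ?_ (le_max_right _ _)
    positivity
  have hdeg : (lseDegree n k β (1 / 2 ^ r) : ℝ)
      ≤ 2 * X + β * k / n * L * 2 ^ r + 3 * k * Real.log (2 * k) / n + 1 := by
    unfold lseDegree
    push_cast
    linarith [Nat.floor_le hth0]
  have hnk : 1 ≤ (n : ℝ) / k := by rwa [le_div_iff₀ hk0, one_mul]
  calc 2 * (n : ℝ) * lseDegree n k β (1 / 2 ^ r) / k
      ≤ 2 * (n : ℝ) * (2 * X + β * k / n * L * 2 ^ r + 3 * k * Real.log (2 * k) / n + 1) / k := by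
        gcongr
    _ = (n : ℝ) / k * (4 * X + 2) + 6 * Real.log (2 * k) + 2 * (β * L) * 2 ^ r := by
        field_simp; ring
    -- Here 14 is 12 + 2: the Chernoff term gives `12 * K`, using `k ≤ n`, and the rounding of the
    -- degree gives 2, which is at most `2 * K` as `k ≥ 2`.
    _ ≤ 14 * ((n : ℝ) / k * (X + K)) + 2 * (β * L) * 2 ^ r := by
        have h1 : 6 * Real.log (2 * k) ≤ (n : ℝ) / k * (12 * K) := by
          calc 6 * Real.log (2 * k) ≤ 1 * (12 * K) := by linarith
            _ ≤ _ := by gcongr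
        have h2 : (n : ℝ) / k * (4 * X + 2) + (n : ℝ) / k * (12 * K)
            ≤ (n : ℝ) / k * (14 * (X + K)) := by
          rw [← mul_add]; gcongr; linarith
        linarith

theorem one_le_logb_exp_div {β : ℝ} (hβ : 0 < β) (hβ1 : β < 1) :
    1 ≤ Real.logb (1 / β) (Real.exp 1 / β) := by
  have h1 : 1 < 1 / β := by rw [lt_div_iff₀ hβ]; linarith
  rw [Real.le_logb_iff_rpow_le h1 (by positivity), Real.rpow_one]
  gcongr
  linarith [Real.add_one_le_exp 1]

theorem logb_exp_sq_nonneg {β D : ℝ} (hβ : 0 < β) (hβ1 : β < 1) (hD : 0 < D) (hD1 : D ≤ 1) :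
    0 ≤ Real.logb (1 / β) (Real.exp 1 ^ 2 * (1 / D)) := by
  have h1 : 1 < 1 / β := by rw [lt_div_iff₀ hβ]; linarith
  apply Real.logb_nonneg h1
  have h2 : 1 ≤ 1 / D := by rwa [le_div_iff₀ hD, one_mul]
  have h3 : 1 ≤ Real.exp 1 := by linarith [Real.add_one_le_exp 1]
  nlinarith [one_le_pow₀ (n := 2) h3]

/-- The graph queries of the first `R` phases, together with the verification of claims. -/
theorem sum_lseDegree_le {n k R : ℕ} {β D : ℝ} (hk : 2 ≤ k) (hkn : k ≤ n) (hβ : 0 < β)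
    (hβ1 : β < 1) (hD : 0 < D) (hD1 : D ≤ 1) (hR : (2 : ℝ) ^ R ≤ 2 / D) :
    ∑ r ∈ Finset.range R, 2 * (n : ℝ) * lseDegree n k β (1 / 2 ^ (r + 1)) / k + 2 * k
      ≤ 28 * disjunctQueryBound n k β D := by
  have hL := one_le_logb_exp_div hβ hβ1
  have hX := logb_exp_sq_nonneg hβ hβ1 hD hD1
  have hK : 0 ≤ Real.logb 2 k := Real.logb_nonneg one_lt_two (by exact_mod_cast (by omega : 1 ≤ k))
  unfold disjunctQueryBound
  set L := Real.logb (1 / β) (Real.exp 1 / β)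
  set F := (n : ℝ) / k * (Real.logb (1 / β) (Real.exp 1 ^ 2 * (1 / D)) + Real.logb 2 k) with hF
  set m := max 1 (Real.logb 2 (1 / D)) with hm
  have hF0 : 0 ≤ F := by positivity
  -- `R ≤ 1 + log₂ (1/D)`, and both summands are at most `m`.
  have hRm : (R : ℝ) ≤ 2 * m := by
    have h1 : (R : ℝ) ≤ Real.logb 2 (2 / D) := by
      rw [Real.le_logb_iff_rpow_le one_lt_two (by positivity), Real.rpow_natCast]
      exact hR
    rw [← mul_one_div, Real.logb_mul two_ne_zero (by positivity),
      Real.logb_self_eq_one one_lt_two] at h1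
    linarith [le_max_left 1 (Real.logb 2 (1 / D)), le_max_right 1 (Real.logb 2 (1 / D))]
  have hgeom : ∑ r ∈ Finset.range R, (2 : ℝ) ^ (r + 1) ≤ 4 * (1 / D) := by
    have h1 : ∑ r ∈ Finset.range R, (2 : ℝ) ^ (r + 1) = 2 * (2 ^ R - 1) := by
      simp_rw [pow_succ]
      rw [← Finset.sum_mul, geom_sum_eq (by norm_num)]
      ring
    rw [h1]
    have : 2 / D = 2 * (1 / D) := by ring
    linarith
  have hsum : ∑ r ∈ Finset.range R, 2 * (n : ℝ) * lseDegree n k β (1 / 2 ^ (r + 1)) / k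
      ≤ ∑ r ∈ Finset.range R, (14 * F + 2 * (β * L) * 2 ^ (r + 1)) := by
    refine Finset.sum_le_sum fun r hr => lseDegree_le hk hkn hβ hβ1 hD hD1 ?_
    exact (pow_le_pow_right₀ one_le_two (Finset.mem_range.1 hr)).trans hR
  rw [Finset.sum_add_distrib, Finset.sum_const, Finset.card_range, nsmul_eq_mul,
    ← Finset.mul_sum] at hsum
  have h1 : (R : ℝ) * (14 * F) ≤ 28 * (F * m) := by nlinarith
  have h2 : 2 * (β * L) * ∑ r ∈ Finset.range R, (2 : ℝ) ^ (r + 1)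
      ≤ 2 * (β * L) * (4 * (1 / D)) := by gcongr
  have h3 : 0 ≤ 1 / D * (β * L) := by positivity
  have h4 : (0 : ℝ) ≤ k := by positivity
  linarith

theorem disjunctQueryBound_nonneg {n k : ℕ} {β D : ℝ} (hk : 0 < k) (hβ : 0 < β)
    (hβ1 : β < 1) (hD : 0 < D) (hD1 : D ≤ 1) : 0 ≤ disjunctQueryBound n k β D := by
  have hL := one_le_logb_exp_div hβ hβ1
  have hX := logb_exp_sq_nonneg hβ hβ1 hD hD1
  have hK : 0 ≤ Real.logb 2 k := Real.logb_nonneg one_lt_two (by exact_mod_cast hk)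
  unfold disjunctQueryBound
  positivity

/-- For `D = 1/n` this reads `n * β ≤ q`, which pays for the final scan of the zero input. -/
theorem le_disjunctQueryBound {n k : ℕ} {β D : ℝ} (hk : 0 < k) (hβ : 0 < β)
    (hβ1 : β < 1) (hD : 0 < D) (hD1 : D ≤ 1) : 1 / D * β ≤ disjunctQueryBound n k β D := by
  have hL := one_le_logb_exp_div hβ hβ1
  have hX := logb_exp_sq_nonneg hβ hβ1 hD hD1
  have hK : 0 ≤ Real.logb 2 k := Real.logb_nonneg one_lt_two (by exact_mod_cast hk)
  unfold disjunctQueryBound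
  have h1 : 1 / D * β ≤ 1 / D * (β * Real.logb (1 / β) (Real.exp 1 / β)) := by
    gcongr
    exact le_mul_of_one_le_right hβ.le hL
  have h2 : 0 ≤ (n : ℝ) / k * (Real.logb (1 / β) (Real.exp 1 ^ 2 * (1 / D)) + Real.logb 2 k)
      * max 1 (Real.logb 2 (1 / D)) := by positivity
  have h3 : (0 : ℝ) ≤ k := by positivity
  linarith

/-! ### The main theorem -/

section Main

variable {n k : ℕ} {β : ℝ} {G : ℕ → BipGraph n k} {A : CCAAdversary n k}

theorem IsLSEFamily.sum_rightNbrs_le (hG : IsLSEFamily β G) {R : ℕ} (hR : R ≤ Nat.clog 2 n)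
    (l : Fin k) :
    ((∑ r ∈ Finset.range R, ((G (r + 1)).rightNbrs l).card : ℕ) : ℝ)
      ≤ ∑ r ∈ Finset.range R, 2 * (n : ℝ) * lseDegree n k β (1 / 2 ^ (r + 1)) / k := by
  push_cast
  refine Finset.sum_le_sum fun r hr => ?_
  have := Finset.mem_range.1 hr
  exact (hG (r + 1) (Finset.mem_Icc.2 ⟨by omega, by omega⟩)).2.2 l

theorem two_pow_clog_le (hn : 2 ≤ n) : (2 : ℝ) ^ Nat.clog 2 n ≤ 2 * n := by
  have h1 := Nat.pow_pred_clog_lt_self one_lt_two (x := n) (by omega)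
  have h2 : 0 < Nat.clog 2 n := Nat.clog_pos one_lt_two hn
  obtain ⟨m, hm⟩ := Nat.exists_eq_succ_of_ne_zero h2.ne'
  rw [hm] at h1 ⊢
  have h3 : 2 ^ (m + 1) ≤ 2 * n := by
    rw [pow_succ]
    simp only [Nat.succ_eq_add_one, Nat.pred_eq_sub_one, Nat.add_sub_cancel] at h1
    omega
  exact_mod_cast h3

theorem lseRoundComplexity_le_log (hn : 2 ≤ n) :
    ((lseDisjunct1 G).roundComplexity A : ℝ) ≤ 5 * Real.logb 2 n := by
  have h1 : (lseDisjunct1 G).roundComplexity A ≤ 2 * Nat.clog 2 n + 1 :=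
    lseRoundComplexity_le fun l _ => lseRun_out_isSome_final l
  have hn2 : (2 : ℝ) ≤ n := by exact_mod_cast hn
  have h2 : 1 ≤ Real.logb 2 n := by
    rw [Real.le_logb_iff_rpow_le one_lt_two (by linarith), Real.rpow_one]; exact hn2
  have h3 : (Nat.clog 2 n : ℝ) ≤ 1 + Real.logb 2 n := by
    have : (Nat.clog 2 n : ℝ) ≤ Real.logb 2 (2 * n) := by
      rw [Real.le_logb_iff_rpow_le one_lt_two (by linarith), Real.rpow_natCast]
      exact two_pow_clog_le hn
    rwa [Real.logb_mul two_ne_zero (by linarith), Real.logb_self_eq_one one_lt_two] at this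
  have h4 : ((lseDisjunct1 G).roundComplexity A : ℝ) ≤ 2 * Nat.clog 2 n + 1 := by
    exact_mod_cast h1
  linarith

/-- The first phase whose expander captures a set of `c` bits. -/
theorem exists_phase {c : ℕ} (hn : 2 ≤ n) (hc : 0 < c) (hcn : c ≤ n) :
    ∃ R, 0 < R ∧ R ≤ Nat.clog 2 n ∧ n ≤ c * 2 ^ R ∧ c * 2 ^ R ≤ 2 * n := by
  have hclog : 0 < Nat.clog 2 n ∧ n ≤ c * 2 ^ Nat.clog 2 n :=
    ⟨Nat.clog_pos one_lt_two hn,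
      (Nat.le_pow_clog one_lt_two n).trans (Nat.le_mul_of_pos_left _ hc)⟩
  have hex : ∃ R, 0 < R ∧ n ≤ c * 2 ^ R := ⟨_, hclog⟩
  refine ⟨Nat.find hex, (Nat.find_spec hex).1, Nat.find_min' hex hclog, (Nat.find_spec hex).2, ?_⟩
  obtain ⟨m, hm⟩ := Nat.exists_eq_succ_of_ne_zero (Nat.find_spec hex).1.ne'
  have hmin := Nat.find_min hex (m := m) (by omega)
  rw [hm]
  -- For `R = 1` minimality says nothing, and `c ≤ n` is used; otherwise phase `R - 1` fails, giving
  -- `c * 2 ^ (R - 1) < n`.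
  rcases Nat.eq_zero_or_pos m with rfl | hm0
  · simp; omega
  · have : c * 2 ^ m < n := by
      by_contra! h
      exact hmin ⟨hm0, h⟩
    rw [Nat.succ_eq_add_one, pow_succ]
    nlinarith

theorem modDensity_density_pos (hn : 0 < n) : 0 < modDensity n A.density :=
  lt_max_of_lt_left (by positivity)

theorem modDensity_density_le_one (hn : 0 < n) : modDensity n A.density ≤ 1 := by
  have hn1 : (1 : ℝ) ≤ n := by exact_mod_cast hn
  apply max_le
  · rw [div_le_one (by linarith)]; exact hn1
  · rw [CCAAdversary.density, div_le_one (by linarith)]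
    have h : (Finset.univ.filter fun x => A.input x = true).card ≤ n := by
      simpa using Finset.card_le_univ (Finset.univ.filter fun x => A.input x = true)
    exact_mod_cast h

/-- The ones themselves are the large set: with `c` of them, all honest machines stop by the end of
the first phase `R` with `n ≤ c * 2 ^ R`, so the scan is never reached. -/
theorem lseQueryComplexity_le_of_exists (hG : IsLSEFamily β G) (hk : 2 ≤ k) (hkn : k ≤ n)
    (hβ : 0 < β) (hβ1 : β < 1) (hA : (A.byz.card : ℝ) ≤ β * k) (hx : ∃ x, A.input x = true) :
    ((lseDisjunct1 G).queryComplexity A : ℝ)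
      ≤ 28 * disjunctQueryBound n k β (modDensity n A.density) := by
  have hn0 : 0 < n := by omega
  have hn' : (0 : ℝ) < n := by exact_mod_cast hn0
  set c := (Finset.univ.filter fun x => A.input x = true).card with hc
  have hc0 : 0 < c := by
    obtain ⟨x, hx⟩ := hx
    exact Finset.card_pos.2 ⟨x, by simpa using hx⟩
  have hc' : (0 : ℝ) < c := by exact_mod_cast hc0
  have hcn : c ≤ n := by
    simpa using Finset.card_le_univ (Finset.univ.filter fun x => A.input x = true)
  have hD : modDensity n A.density = c / n := by
    rw [modDensity, CCAAdversary.density, ← hc]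
    apply max_eq_right
    gcongr
    exact_mod_cast hc0
  obtain ⟨R, hR0, hR, hcR, hRc⟩ := exists_phase (n := n) (by omega) hc0 hcn
  have hT : (lseDisjunct1 G).roundComplexity A ≤ 2 * R := by
    refine lseRoundComplexity_le fun l _ =>
      lseRun_out_of_isLSE hR0 hR (hG R (Finset.mem_Icc.2 ⟨hR0, hR⟩)).1 hA ?_ l
    rw [← hc, mul_one_div, div_le_iff₀ (by positivity)]
    exact_mod_cast hcR
  have hpow : (2 : ℝ) ^ R ≤ 2 / modDensity n A.density := by
    rw [hD, le_div_iff₀ (by positivity), ← mul_div_assoc, div_le_iff₀ hn']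
    have : (c : ℝ) * 2 ^ R ≤ 2 * n := by exact_mod_cast hRc
    linarith
  have hsum := sum_lseDegree_le hk hkn hβ hβ1 (modDensity_density_pos (A := A) hn0)
    (modDensity_density_le_one hn0) hpow
  refine le_trans ?_ hsum
  have hB := lseQueryComplexity_le (G := G) hT
    (B := Finset.univ.sup fun l => ∑ u ∈ Finset.range (2 * R), ownQueries G l u)
    fun l => Finset.le_sup (f := fun l => ∑ u ∈ Finset.range (2 * R), ownQueries G l u)
      (Finset.mem_univ l)
  -- A machine with the largest number of graph queries realises the supremum, so the degree bound
  -- applies to it.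
  obtain ⟨l, -, hl⟩ := Finset.exists_mem_eq_sup (Finset.univ : Finset (Fin k))
    ⟨⟨0, by omega⟩, Finset.mem_univ _⟩ fun l => ∑ u ∈ Finset.range (2 * R), ownQueries G l u
  rw [hl, sum_ownQueries_two_mul l hR] at hB
  have hB' : ((lseDisjunct1 G).queryComplexity A : ℝ)
      ≤ ((∑ r ∈ Finset.range R, ((G (r + 1)).rightNbrs l).card : ℕ) : ℝ) + 2 * k := by
    exact_mod_cast hB
  linarith [hG.sum_rightNbrs_le hR l]

/-- Here no early stop is available: all `⌈log₂ n⌉` phases are charged, with `2 ^ ⌈log₂ n⌉ ≤ 2n = 2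
/ D`, and the extra `n` is the final scan. -/
theorem lseQueryComplexity_le_of_forall (hG : IsLSEFamily β G) (hk : 2 ≤ k) (hkn : k ≤ n)
    (hβ : 0 < β) (hβ1 : β < 1) (hx : ¬ ∃ x, A.input x = true) :
    ((lseDisjunct1 G).queryComplexity A : ℝ)
      ≤ 28 * disjunctQueryBound n k β (modDensity n A.density) + n ∧
      modDensity n A.density = 1 / n := by
  have hn0 : 0 < n := by omega
  have hn' : (0 : ℝ) < n := by exact_mod_cast hn0
  have hD : modDensity n A.density = 1 / n := by
    have : A.density = 0 := by
      push Not at hx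
      simp [CCAAdversary.density, hx]
    rw [this]
    exact max_eq_left (by positivity)
  refine ⟨?_, hD⟩
  have hT : (lseDisjunct1 G).roundComplexity A ≤ 2 * Nat.clog 2 n + 1 :=
    lseRoundComplexity_le fun l _ => lseRun_out_isSome_final l
  have hpow : (2 : ℝ) ^ Nat.clog 2 n ≤ 2 / modDensity n A.density := by
    rw [hD, div_div_eq_mul_div, div_one]
    exact two_pow_clog_le (by omega)
  have hsum := sum_lseDegree_le hk hkn hβ hβ1 (modDensity_density_pos (A := A) hn0)
    (modDensity_density_le_one hn0) hpow
  refine le_trans ?_ (add_le_add_left hsum _)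
  set f : Fin k → ℕ := fun l => ∑ r ∈ Finset.range (Nat.clog 2 n), ((G (r + 1)).rightNbrs l).card
    with hf
  have hB := lseQueryComplexity_le (G := G) hT (B := Finset.univ.sup f + n) fun l => by
    rw [Finset.sum_range_succ, sum_ownQueries_two_mul l le_rfl]
    have h1 : f l ≤ Finset.univ.sup f := Finset.le_sup (Finset.mem_univ l)
    have h2 : ownQueries G l (2 * Nat.clog 2 n) = n := by simp [ownQueries]
    rw [h2]
    exact Nat.add_le_add_right h1 n
  obtain ⟨l, -, hl⟩ := Finset.exists_mem_eq_sup (Finset.univ : Finset (Fin k))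
    ⟨⟨0, by omega⟩, Finset.mem_univ _⟩ f
  rw [hl] at hB
  have hB' : ((lseDisjunct1 G).queryComplexity A : ℝ) ≤ (f l : ℝ) + n + 2 * k := by
    exact_mod_cast hB
  linarith [hG.sum_rightNbrs_le le_rfl l]

end Main

theorem mainTheorem7 :
    ∃ C : ℝ, 0 < C ∧ ∀ (n k : ℕ) (β : ℝ), 0 < k → k ≤ n → 0 < β → β < 1 →
      (∃ b : ℕ, β * k = b) →
      (∃ G : ℕ → BipGraph n k, IsLSEFamily β G) ∧
      ∀ G : ℕ → BipGraph n k, IsLSEFamily β G →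
        ∀ A : CCAAdversary n k, (A.byz.card : ℝ) ≤ β * k →
          (lseDisjunct1 G).SolvesDisjunction A ∧
          ((∃ x, A.input x = true) →
            ((lseDisjunct1 G).queryComplexity A : ℝ)
              ≤ C * disjunctQueryBound n k β (modDensity n A.density)) ∧
          ((lseDisjunct1 G).queryComplexity A : ℝ)
            ≤ C / β * disjunctQueryBound n k β (modDensity n A.density) ∧
          ((lseDisjunct1 G).roundComplexity A : ℝ) ≤ C * Real.logb 2 n ∧
          ((lseDisjunct1 G).messageComplexity A : ℝ)
            ≤ C / β * (β * (k : ℝ) ^ 2 * Real.logb 2 n) := by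
  -- 28 from the phases and 1 from the final scan; the round bound needs only 5.
  refine ⟨29, by norm_num, fun n k β hk hkn hβ hβ1 hb =>
    ⟨exists_lseFamily hk hkn hβ hβ1 hb, fun G hG A hA => ?_⟩⟩
  -- The integer `βk` lies strictly between 0 and `k`.
  have hk2 : 2 ≤ k := by
    obtain ⟨b, hb⟩ := hb
    have hk' : (0 : ℝ) < k := by exact_mod_cast hk
    have h1 : (0 : ℝ) < b := by rw [← hb]; positivity
    have h2 : (b : ℝ) < k := by rw [← hb]; nlinarith
    have h3 : 0 < b := by exact_mod_cast h1
    have h4 : b < k := by exact_mod_cast h2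
    omega
  have hn2 : 2 ≤ n := hk2.trans hkn
  have hn' : (0 : ℝ) < n := by positivity
  have hD := modDensity_density_pos (A := A) (by omega : 0 < n)
  have hD1 := modDensity_density_le_one (A := A) (by omega : 0 < n)
  have hq := disjunctQueryBound_nonneg (n := n) hk hβ hβ1 hD hD1
  have hlow := le_disjunctQueryBound (n := n) hk hβ hβ1 hD hD1
  have hrounds := lseRoundComplexity_le_log (G := G) (A := A) hn2
  have hlog : 0 ≤ Real.logb 2 n := Real.logb_nonneg one_lt_two (by exact_mod_cast (by omega))
  set q := disjunctQueryBound n k β (modDensity n A.density) with hqdef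
  have hqβ : q ≤ q / β := by
    rw [le_div_iff₀ hβ]
    nlinarith
  have hsome : (∃ x, A.input x = true) → ((lseDisjunct1 G).queryComplexity A : ℝ) ≤ 29 * q :=
    fun hx => (lseQueryComplexity_le_of_exists hG hk2 hkn hβ hβ1 hA hx).trans (by linarith)
  refine ⟨lseDisjunct1_solves, hsome, ?_, hrounds.trans (by linarith), ?_⟩
  · have e : 29 / β * q = 29 * (q / β) := by ring
    rw [e]
    by_cases hx : ∃ x, A.input x = true
    · linarith [hsome hx]
    · obtain ⟨h1, h2⟩ := lseQueryComplexity_le_of_forall hG hk2 hkn hβ hβ1 hx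
      -- With `D = 1/n` the lower bound on `q` becomes `n ≤ q / β`.
      rw [h2, one_div_one_div, ← le_div_iff₀ hβ] at hlow
      linarith
  · have h1 : ((lseDisjunct1 G).messageComplexity A : ℝ)
        ≤ (lseDisjunct1 G).roundComplexity A * (k * k) := by
      exact_mod_cast lseMessageComplexity_le
    have e : 29 / β * (β * (k : ℝ) ^ 2 * Real.logb 2 n) = 29 * Real.logb 2 n * (k * k) := by
      field_simp
    rw [e]
    refine h1.trans ?_
    gcongr
    linarith
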